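/- For an entire function $f(z)=\sum_{n\ge 0}a_nz^n$ and $r>0$ put $M(r,f)=\max_{|z|=r}|f(z)|$, $\mu(r,f)=\max_{n\ge 0}|a_n|r^n$, and for $f$ not identically zero $$\beta(f)=\liminf_{r\to\infty}\frac{\mu(r,f)}{M(r,f)} .$$ Let $B=\sup_f\beta(f)$, the supremum being taken over all transcendental entire functions $f$ (entire functions that are not polynomials). **Theorem.** Let $K_0=\frac{7137}{2000}$, $\alpha_0=\frac{198074929}{50000000}$ and $\varepsilon_0=e^{i\alpha_0}$, so that $K_0>1$ and $|\varepsilon_0|=1$. The power series $$f_{K_0,\varepsilon_0}(z)=\sum_{n=0}^{\infty}\frac{\varepsilon_0^{\,n(n-1)/2}}{K_0^{\,n(n+1)/2}}\,z^n$$ converges for every $z\in\mathbb C$ and defines a transcendental entire function, which satisfies $$\beta(f_{K_0,\varepsilon_0})>0.58507 .$$ Consequently, $B>0.58507$. -/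

import Mathlib

/-- A transcendental entire function: holomorphic on all of `ℂ` and not a polynomial function. -/
def IsTranscendentalEntire (f : ℂ → ℂ) : Prop :=
  Differentiable ℂ f ∧ ¬ ∃ p : Polynomial ℂ, ∀ z : ℂ, f z = p.eval z

/-- The maximum modulus `M(r, f) = max_{|z| = r} |f(z)|`. For `f` continuous and `r ≥ 0` the
supremum is attained, the circle being compact and nonempty. -/
noncomputable def maxModulus (r : ℝ) (f : ℂ → ℂ) : ℝ :=
  sSup ((fun z : ℂ => ‖f z‖) '' Metric.sphere (0 : ℂ) r)

/-- The coefficient `a_n = f^{(n)}(0) / n!` of the power series `f(z) = ∑ a_n z^n` of an entire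
function. -/
noncomputable def taylorCoeff (f : ℂ → ℂ) (n : ℕ) : ℂ :=
  iteratedDeriv n f 0 / (n.factorial : ℂ)

/-- The maximum term `μ(r, f) = max_{n ≥ 0} |a_n| r^n`. For `f` entire and `r ≥ 0` the terms tend
to zero, so that the supremum is attained. -/
noncomputable def maxTerm (r : ℝ) (f : ℂ → ℂ) : ℝ :=
  ⨆ n : ℕ, ‖taylorCoeff f n‖ * r ^ n

/-- `β(f) = liminf_{r → ∞} μ(r, f) / M(r, f)`. For `f` entire the ratio lies in `[0, 1]` for every
`r ≥ 0` by Cauchy's inequality, so that this is the genuine lower limit. -/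
noncomputable def erdosRatio (f : ℂ → ℂ) : ℝ :=
  Filter.liminf (fun r : ℝ => maxTerm r f / maxModulus r f) Filter.atTop

/-- The constant `B = sup_f β(f)`, the supremum being over all transcendental entire functions.
All the values `β(f)` lie in `[0, 1]`. -/
noncomputable def erdosB : ℝ :=
  sSup {b : ℝ | ∃ f : ℂ → ℂ, IsTranscendentalEntire f ∧ b = erdosRatio f}

/-- The coefficient `ε^{n(n-1)/2} K^{-n(n+1)/2}`. Both divisions by two are exact, and at `n = 0`
the truncated subtraction does no harm. -/
noncomputable def scalingCoeff (K : ℝ) (ε : ℂ) (n : ℕ) : ℂ :=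
  ε ^ (n * (n - 1) / 2) / (K : ℂ) ^ (n * (n + 1) / 2)

/-- `f_{K,ε}(z) = ∑_{n ≥ 0} ε^{n(n-1)/2} K^{-n(n+1)/2} z^n`. -/
noncomputable def scalingFun (K : ℝ) (ε : ℂ) (z : ℂ) : ℂ :=
  ∑' n : ℕ, scalingCoeff K ε n * z ^ n

/-! Put `q = ε/K`. On the circle `|z| = K^(m+1)` the terms of index `m` and `m+1` tie for the
largest modulus. Dividing the series by the term of index `m+1` leaves a one-sided truncation of the
theta series `∑ q^(j(j+1)/2) u^j` with `|u| = 1`. Writing `u = v²` and pairing `j` with `-j-1`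
gives, up to the unimodular factor `v⁻¹`, the sum of `q^(j(j+1)/2) (v^(2j+1) + v^(-2j-1))`. Four
pairs contribute at most 1.709186 and the remainder less than 1e-5 (`norm_theta_main_le`,
`norm_theta_truncation_le`).

Between two consecutive such circles, the maximum principle applied to `f(z)/z^(m+1)` extends the
estimate (`norm_scalingFun_le`). Hence `M ≤ 1.709196 μ` for all `r ≥ K^4`, and `1/1.709196 >
0.58507`. -/

/-! ### Numerical bound for the four dominant pairs. -/

/-- The degree seven trigonometric polynomial bound, in terms of `X = (v + v⁻¹)²`. -/
theorem theta_polynomial_bound {X : ℝ} (h0 : 0 ≤ X) (h4 : X ≤ 4) :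
    X * ((1 + -95599 / 500000 * (X - 3) + 85427 / 5000000 * (X ^ 2 - 5 * X + 5)
        + 249 / 2500000 * (X ^ 3 - 7 * X ^ 2 + 14 * X - 7)) ^ 2
      + (-2048709 / 10000000 * (X - 3) + -138693 / 10000000 * (X ^ 2 - 5 * X + 5)
        + -4739 / 10000000 * (X ^ 3 - 7 * X ^ 2 + 14 * X - 7)) ^ 2)
      ≤ (1.709185 : ℝ) ^ 2 := by
  obtain ⟨x, rfl⟩ : ∃ x, X = 4 * x := ⟨X / 4, by ring⟩
  have hx0 : 0 ≤ x := by linarith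
  have hx1 : 0 ≤ 1 - x := by linarith
  -- The bound is almost attained both at the interior maximum `x ≈ 0.6381` and at the endpoint `x =
  -- 1`. The certificate is therefore built on the double factor `(x - 0.6381)²` and the factor `1 -
  -- x`.
  have hs := sq_nonneg (x - 0.6381)
  have h1 := mul_nonneg hs hx1
  have h2 := mul_nonneg h1 hx1
  have h3 := mul_nonneg h1 hx0
  have h5 := mul_nonneg h3 hx0
  have h6 := mul_nonneg h5 hx0
  have h7 := mul_nonneg h6 hx0
  norm_num at *
  linarith

theorem norm_mk_le {a b C : ℝ} (hC : 0 ≤ C) (h : a ^ 2 + b ^ 2 ≤ C ^ 2) :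
    ‖(a + b * Complex.I : ℂ)‖ ≤ C := by
  rw [Complex.norm_add_mul_I]
  exact Real.sqrt_le_iff.2 ⟨hC, h⟩

/-- The angle is `α₀/4`: it is less than 1, as the Taylor remainder bound requires, whereas `α₀` is
close to 4. The fourth power recovers `ε₀`. -/
theorem norm_exp_quarter_angle_sub_le :
    ‖Complex.exp (Complex.I * ((198074929 / 200000000 : ℝ) : ℂ))
      - ((0.548376609 : ℝ) + (0.836231484 : ℝ) * Complex.I)‖ ≤ 1e-8 := by
  have hn : ‖Complex.I * ((198074929 / 200000000 : ℝ) : ℂ)‖ = 198074929 / 200000000 := by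
    rw [norm_mul, Complex.norm_I, Complex.norm_real, one_mul]; norm_num
  have h := Complex.exp_bound (x := Complex.I * ((198074929 / 200000000 : ℝ) : ℂ))
    (by rw [hn]; norm_num) (n := 12) (by norm_num)
  rw [hn] at h
  have hS : ∀ t : ℝ, ∑ m ∈ Finset.range 12, (Complex.I * (t : ℂ)) ^ m / (m.factorial : ℂ) =
      ((1 - t ^ 2 / 2 + t ^ 4 / 24 - t ^ 6 / 720 + t ^ 8 / 40320 - t ^ 10 / 3628800 : ℝ) : ℂ)
      + ((t - t ^ 3 / 6 + t ^ 5 / 120 - t ^ 7 / 5040 + t ^ 9 / 362880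
        - t ^ 11 / 39916800 : ℝ) : ℂ) * Complex.I := by
    intro t
    have h2 := Complex.I_sq
    have h4 := Complex.I_pow_four
    have h3 : Complex.I ^ 3 = -Complex.I := Complex.I_pow_three
    have h5 : Complex.I ^ 5 = Complex.I := by rw [pow_succ, h4, one_mul]
    have h6 : Complex.I ^ 6 = -1 := by rw [pow_succ, h5, ← sq, h2]
    have h7 : Complex.I ^ 7 = -Complex.I := by rw [pow_succ, h6, neg_one_mul]
    have h8 : Complex.I ^ 8 = 1 := by rw [show 8 = 4 * 2 by rfl, pow_mul, h4, one_pow]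
    have h9 : Complex.I ^ 9 = Complex.I := by rw [pow_succ, h8, one_mul]
    have h10 : Complex.I ^ 10 = -1 := by rw [pow_succ, h9, ← sq, h2]
    have h11 : Complex.I ^ 11 = -Complex.I := by rw [pow_succ, h10, neg_one_mul]
    simp only [Finset.sum_range_succ, Finset.sum_range_zero, mul_pow, h2, h3, h4, h5, h6, h7, h8,
      h9, h10, h11, Nat.factorial]
    push_cast
    ring
  rw [hS] at h
  refine (norm_sub_le_norm_sub_add_norm_sub _ _ _).trans ((add_le_add
    (h.trans (?_ : _ ≤ (3e-9 : ℝ))) (?_ : _ ≤ (7e-9 : ℝ))).trans ?_)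
  · norm_num [Nat.factorial]
  · rw [show ∀ a b c d : ℝ, (a + b * Complex.I : ℂ) - (c + d * Complex.I)
      = ((a - c : ℝ) : ℂ) + ((b - d : ℝ) : ℂ) * Complex.I by intros; push_cast; ring]
    apply norm_mk_le <;> norm_num
  · norm_num

/-- The complex number `ε / K` for the parameters of the theorem, approximately. -/
theorem norm_ratio_sub_le {q : ℂ}
    (hq : q = Complex.exp (Complex.I * ((198074929 / 50000000 : ℝ) : ℂ)) / ((7137 / 2000 : ℝ) : ℂ)) :
    ‖q - ((-95599 / 500000 : ℝ) + (-2048709 / 10000000 : ℝ) * Complex.I)‖ ≤ 1e-7 := by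
  set e := Complex.exp (Complex.I * ((198074929 / 200000000 : ℝ) : ℂ)) with he
  set c : ℂ := (0.548376609 : ℝ) + (0.836231484 : ℝ) * Complex.I with hc
  have hec : ‖e - c‖ ≤ 1e-8 := norm_exp_quarter_angle_sub_le
  have he1 : ‖e‖ = 1 := by rw [he, mul_comm, Complex.norm_exp_ofReal_mul_I]
  have hc1 : ‖c‖ ≤ 1.01 := norm_mk_le (by norm_num) (by norm_num)
  have hqe : q = e ^ 4 / ((7137 / 2000 : ℝ) : ℂ) := by
    rw [hq, he, ← Complex.exp_nat_mul]
    congr 2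
    push_cast
    ring
  have h4 : ‖e ^ 4 - c ^ 4‖ ≤ 4.2e-8 := by
    have h1 : ‖e + c‖ ≤ 2.01 := (norm_add_le _ _).trans (by rw [he1]; linarith)
    have h2 : ‖e ^ 2 + c ^ 2‖ ≤ 2.03 := by
      refine (norm_add_le _ _).trans ?_
      rw [norm_pow, norm_pow, he1]
      nlinarith [norm_nonneg c]
    calc ‖e ^ 4 - c ^ 4‖ = ‖e - c‖ * ‖e + c‖ * ‖e ^ 2 + c ^ 2‖ := by
          rw [← norm_mul, ← norm_mul]; congr 1; ring
      _ ≤ 1e-8 * 2.01 * 2.03 := by gcongr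
      _ ≤ _ := by norm_num
  have hI := Complex.I_sq
  have hc4 : ‖c ^ 4 / ((7137 / 2000 : ℝ) : ℂ)
      - ((-95599 / 500000 : ℝ) + (-2048709 / 10000000 : ℝ) * Complex.I)‖ ≤ 8e-8 := by
    have : c ^ 4 / ((7137 / 2000 : ℝ) : ℂ)
      - ((-95599 / 500000 : ℝ) + (-2048709 / 10000000 : ℝ) * Complex.I)
      = (((((0.548376609 : ℝ) ^ 2 - 0.836231484 ^ 2) ^ 2
          - (2 * 0.548376609 * 0.836231484) ^ 2) * (2000 / 7137) - -95599 / 500000 : ℝ) : ℂ)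
        + (((2 * ((0.548376609 : ℝ) ^ 2 - 0.836231484 ^ 2) * (2 * 0.548376609 * 0.836231484))
          * (2000 / 7137) - -2048709 / 10000000 : ℝ) : ℂ) * Complex.I := by
      rw [hc]
      generalize (0.548376609 : ℝ) = a
      generalize (0.836231484 : ℝ) = b
      have hs : ((a : ℂ) + b * Complex.I) ^ 4 = ((a ^ 2 - b ^ 2) ^ 2 - (2 * a * b) ^ 2)
          + 2 * (a ^ 2 - b ^ 2) * (2 * a * b) * Complex.I := by
        have : ((a : ℂ) + b * Complex.I) ^ 2 = (a ^ 2 - b ^ 2) + 2 * a * b * Complex.I := by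
          linear_combination (b : ℂ) ^ 2 * hI
        rw [show 4 = 2 * 2 by rfl, pow_mul, this]
        linear_combination (2 * (a : ℂ) * b) ^ 2 * hI
      rw [hs]
      push_cast
      ring
    rw [this]
    apply norm_mk_le <;> norm_num
  refine (norm_sub_le_norm_sub_add_norm_sub _ (c ^ 4 / ((7137 / 2000 : ℝ) : ℂ)) _).trans
    ((add_le_add (?_ : _ ≤ (2e-8 : ℝ)) hc4).trans ?_)
  · rw [hqe, ← sub_div, norm_div, Complex.norm_real]
    norm_num at h4 ⊢
    linarith
  · norm_num

theorem norm_pow_three_sub_pow_three_le {q a : ℂ} {r : ℝ} (hq : ‖q‖ ≤ r) (ha : ‖a‖ ≤ r) :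
    ‖q ^ 3 - a ^ 3‖ ≤ 3 * r ^ 2 * ‖q - a‖ := by
  have h : ‖q ^ 2 + q * a + a ^ 2‖ ≤ r ^ 2 + r * r + r ^ 2 := by
    have hr : 0 ≤ r := (norm_nonneg _).trans hq
    refine (norm_add₃_le).trans ?_
    rw [norm_pow, norm_pow, norm_mul]
    gcongr
  calc ‖q ^ 3 - a ^ 3‖ = ‖q ^ 2 + q * a + a ^ 2‖ * ‖q - a‖ := by
        rw [← norm_mul]; congr 1; ring
    _ ≤ (r ^ 2 + r * r + r ^ 2) * ‖q - a‖ := by gcongr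
    _ = _ := by ring

/-- The four dominant pairs of terms of the theta series. -/
theorem norm_theta_main_le {q v : ℂ}
    (hq : q = Complex.exp (Complex.I * ((198074929 / 50000000 : ℝ) : ℂ)) / ((7137 / 2000 : ℝ) : ℂ))
    (hv : ‖v‖ = 1) :
    ‖(v + v⁻¹) + q * (v ^ 3 + v⁻¹ ^ 3) + q ^ 3 * (v ^ 5 + v⁻¹ ^ 5) + q ^ 6 * (v ^ 7 + v⁻¹ ^ 7)‖
      ≤ 1.709186 := by
  have hq1 := norm_ratio_sub_le hq
  set a₁ : ℂ := (-95599 / 500000 : ℝ) + (-2048709 / 10000000 : ℝ) * Complex.I with ha₁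
  set a₃ : ℂ := (85427 / 5000000 : ℝ) + (-138693 / 10000000 : ℝ) * Complex.I with ha₃
  set a₆ : ℂ := (249 / 2500000 : ℝ) + (-4739 / 10000000 : ℝ) * Complex.I with ha₆
  have hI := Complex.I_sq
  have hqn : ‖q‖ ≤ 0.281 := by
    rw [hq, norm_div, mul_comm, Complex.norm_exp_ofReal_mul_I, Complex.norm_real]
    norm_num
  have ha₁n : ‖a₁‖ ≤ 0.281 := norm_mk_le (by norm_num) (by norm_num)
  have ha₃n : ‖a₃‖ ≤ 0.03 := norm_mk_le (by norm_num) (by norm_num)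
  have ha13 : ‖a₁ ^ 3 - a₃‖ ≤ 1e-7 := by
    have hs : ∀ a b c d : ℝ, ((a : ℂ) + b * Complex.I) ^ 3 - (c + d * Complex.I)
        = ((a ^ 3 - 3 * a * b ^ 2 - c : ℝ) : ℂ)
          + ((3 * a ^ 2 * b - b ^ 3 - d : ℝ) : ℂ) * Complex.I := by
      intro a b c d
      push_cast
      linear_combination (3 * (a : ℂ) * b ^ 2 + b ^ 3 * Complex.I) * hI
    rw [ha₁, ha₃, hs]
    apply norm_mk_le <;> norm_num
  have ha36 : ‖a₃ ^ 2 - a₆‖ ≤ 1e-7 := by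
    have hs : ∀ a b c d : ℝ, ((a : ℂ) + b * Complex.I) ^ 2 - (c + d * Complex.I)
        = ((a ^ 2 - b ^ 2 - c : ℝ) : ℂ) + ((2 * a * b - d : ℝ) : ℂ) * Complex.I := by
      intro a b c d
      push_cast
      linear_combination (b : ℂ) ^ 2 * hI
    rw [ha₃, ha₆, hs]
    apply norm_mk_le <;> norm_num
  have hq3 : ‖q ^ 3 - a₃‖ ≤ 1.3e-7 := by
    have := norm_pow_three_sub_pow_three_le hqn ha₁n
    refine (norm_sub_le_norm_sub_add_norm_sub _ (a₁ ^ 3) _).trans ?_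
    norm_num at *
    linarith
  have hq6 : ‖q ^ 6 - a₆‖ ≤ 1.2e-7 := by
    have h3 : ‖q ^ 3 + a₃‖ ≤ 0.07 := by
      refine (norm_add_le _ _).trans ?_
      have : ‖q ^ 3‖ ≤ 0.281 ^ 3 := by rw [norm_pow]; gcongr
      norm_num at *
      linarith
    have h6 : ‖q ^ 6 - a₃ ^ 2‖ ≤ 1.3e-7 * 0.07 := by
      rw [show q ^ 6 - a₃ ^ 2 = (q ^ 3 - a₃) * (q ^ 3 + a₃) by ring, norm_mul]
      gcongr
    refine (norm_sub_le_norm_sub_add_norm_sub _ (a₃ ^ 2) _).trans ?_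
    norm_num at *
    linarith
  have hv0 : v ≠ 0 := norm_ne_zero_iff.1 (by rw [hv]; norm_num)
  have hpair : ∀ n : ℕ, ‖v ^ n + v⁻¹ ^ n‖ ≤ 2 := fun n => by
    refine (norm_add_le _ _).trans ?_
    rw [norm_pow, norm_pow, norm_inv, hv]
    norm_num
  have hmul := mul_inv_cancel₀ hv0
  -- As `|v| = 1`, `s = 2 Re v` is real. Each odd pair is `s` times a real polynomial in `s²`, so
  -- the real and imaginary parts separate and only `X = s² ∈ [0, 4]` matters.
  obtain ⟨s, hs⟩ : ∃ s : ℝ, v + v⁻¹ = (s : ℂ) := by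
    refine ⟨2 * v.re, ?_⟩
    rw [Complex.inv_eq_conj hv, Complex.add_conj]
  have hs2 : s ^ 2 ≤ 4 := by
    have := hpair 1
    rw [pow_one, pow_one, hs, Complex.norm_real, Real.norm_eq_abs] at this
    nlinarith [abs_nonneg s, sq_abs s]
  have e3 : v ^ 3 + v⁻¹ ^ 3 = (s : ℂ) * ((s : ℂ) ^ 2 - 3) := by
    rw [← hs]
    generalize v⁻¹ = w at *
    linear_combination (-3 * v - 3 * w) * hmul
  have e5 : v ^ 5 + v⁻¹ ^ 5 = (s : ℂ) * ((s : ℂ) ^ 4 - 5 * (s : ℂ) ^ 2 + 5) := by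
    rw [← hs]
    field_simp
    ring
  have e7 : v ^ 7 + v⁻¹ ^ 7 =
      (s : ℂ) * ((s : ℂ) ^ 6 - 7 * (s : ℂ) ^ 4 + 14 * (s : ℂ) ^ 2 - 7) := by
    rw [← hs]
    field_simp
    ring
  have happrox : ‖(v + v⁻¹) + a₁ * (v ^ 3 + v⁻¹ ^ 3) + a₃ * (v ^ 5 + v⁻¹ ^ 5)
      + a₆ * (v ^ 7 + v⁻¹ ^ 7)‖ ≤ 1.709185 := by
    rw [e3, e5, e7, hs]
    convert norm_mk_le (a := s * (1 + -95599 / 500000 * (s ^ 2 - 3)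
        + 85427 / 5000000 * ((s ^ 2) ^ 2 - 5 * s ^ 2 + 5)
        + 249 / 2500000 * ((s ^ 2) ^ 3 - 7 * (s ^ 2) ^ 2 + 14 * s ^ 2 - 7)))
      (b := s * (-2048709 / 10000000 * (s ^ 2 - 3)
        + -138693 / 10000000 * ((s ^ 2) ^ 2 - 5 * s ^ 2 + 5)
        + -4739 / 10000000 * ((s ^ 2) ^ 3 - 7 * (s ^ 2) ^ 2 + 14 * s ^ 2 - 7)))
      (by norm_num : (0 : ℝ) ≤ 1.709185) ?_ using 2
    · rw [ha₁, ha₃, ha₆]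
      push_cast
      ring
    · refine le_trans (le_of_eq ?_) (theta_polynomial_bound (sq_nonneg s) hs2)
      ring
  have hsplit : (v + v⁻¹) + q * (v ^ 3 + v⁻¹ ^ 3) + q ^ 3 * (v ^ 5 + v⁻¹ ^ 5)
      + q ^ 6 * (v ^ 7 + v⁻¹ ^ 7)
      = ((v + v⁻¹) + a₁ * (v ^ 3 + v⁻¹ ^ 3) + a₃ * (v ^ 5 + v⁻¹ ^ 5) + a₆ * (v ^ 7 + v⁻¹ ^ 7))
        + ((q - a₁) * (v ^ 3 + v⁻¹ ^ 3) + (q ^ 3 - a₃) * (v ^ 5 + v⁻¹ ^ 5)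
          + (q ^ 6 - a₆) * (v ^ 7 + v⁻¹ ^ 7)) := by ring
  rw [hsplit]
  refine (norm_add_le _ _).trans ((add_le_add happrox ((norm_add₃_le).trans
    (?_ : _ ≤ (1e-7 * 2 + 1.3e-7 * 2 + 1.2e-7 * 2 : ℝ)))).trans ?_)
  · rw [norm_mul, norm_mul, norm_mul]
    gcongr <;> apply hpair
  · norm_num

/-! ### Maximum modulus, maximum term and Taylor coefficients. -/

theorem norm_le_maxModulus {f : ℂ → ℂ} (hf : Continuous f) (z : ℂ) :
    ‖f z‖ ≤ maxModulus ‖z‖ f :=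
  le_csSup ((isCompact_sphere _ _).bddAbove_image hf.norm.continuousOn)
    ⟨z, by simp, rfl⟩

theorem maxModulus_le {f : ℂ → ℂ} {r C : ℝ} (hr : 0 ≤ r) (h : ∀ z, ‖z‖ = r → ‖f z‖ ≤ C) :
    maxModulus r f ≤ C := by
  refine csSup_le (((NormedSpace.sphere_nonempty).2 hr).image _) ?_
  rintro _ ⟨z, hz, rfl⟩
  exact h z (by simpa using hz)

theorem maxModulus_nonneg (r : ℝ) (f : ℂ → ℂ) : 0 ≤ maxModulus r f :=
  Real.sSup_nonneg (by rintro _ ⟨z, -, rfl⟩; exact norm_nonneg _)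

/-- **Cauchy's inequality** for the Taylor coefficients. -/
theorem norm_taylorCoeff_mul_pow_le {f : ℂ → ℂ} (hf : Differentiable ℂ f) {r : ℝ} (hr : 0 < r)
    (n : ℕ) : ‖taylorCoeff f n‖ * r ^ n ≤ maxModulus r f := by
  have h := Complex.norm_iteratedDeriv_le_of_forall_mem_sphere_norm_le (c := 0) (R := r)
    (C := maxModulus r f) n hr hf.diffContOnCl
    (fun z hz => by
      have := norm_le_maxModulus hf.continuous z
      rwa [mem_sphere_zero_iff_norm.1 hz] at this)
  have hn : (0 : ℝ) < n.factorial := by exact_mod_cast n.factorial_pos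
  rw [taylorCoeff, norm_div, Complex.norm_natCast]
  calc ‖iteratedDeriv n f 0‖ / n.factorial * r ^ n
      ≤ (n.factorial * maxModulus r f / r ^ n) / n.factorial * r ^ n := by gcongr
    _ = maxModulus r f := by field_simp

theorem maxTerm_le_maxModulus {f : ℂ → ℂ} (hf : Differentiable ℂ f) {r : ℝ} (hr : 0 < r) :
    maxTerm r f ≤ maxModulus r f :=
  ciSup_le fun n => norm_taylorCoeff_mul_pow_le hf hr n

theorem le_maxTerm {f : ℂ → ℂ} (hf : Differentiable ℂ f) {r : ℝ} (hr : 0 < r) (n : ℕ) :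
    ‖taylorCoeff f n‖ * r ^ n ≤ maxTerm r f :=
  le_ciSup (f := fun n => ‖taylorCoeff f n‖ * r ^ n)
    ⟨maxModulus r f, by rintro _ ⟨k, rfl⟩; exact norm_taylorCoeff_mul_pow_le hf hr k⟩ n

theorem maxTerm_div_maxModulus_le_one {f : ℂ → ℂ} (hf : Differentiable ℂ f) {r : ℝ} (hr : 0 < r) :
    maxTerm r f / maxModulus r f ≤ 1 :=
  div_le_one_of_le₀ (maxTerm_le_maxModulus hf hr) (maxModulus_nonneg r f)

theorem maxTerm_div_maxModulus_nonneg (f : ℂ → ℂ) {r : ℝ} (hr : 0 < r) :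
    0 ≤ maxTerm r f / maxModulus r f :=
  div_nonneg (Real.iSup_nonneg fun _ => by positivity) (maxModulus_nonneg r f)

theorem erdosRatio_le_one {f : ℂ → ℂ} (hf : Differentiable ℂ f) : erdosRatio f ≤ 1 := by
  refine Filter.liminf_le_of_frequently_le (Filter.Eventually.frequently ?_) ⟨0, ?_⟩
  · filter_upwards [Filter.eventually_gt_atTop 0] with r hr
    exact maxTerm_div_maxModulus_le_one hf hr
  · rw [Filter.eventually_map]
    filter_upwards [Filter.eventually_gt_atTop 0] with r hr
    exact maxTerm_div_maxModulus_nonneg f hr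

/-- A real `liminf` is meaningful only under boundedness; Cauchy's inequality supplies the upper
bound 1. -/
theorem le_erdosRatio {f : ℂ → ℂ} (hf : Differentiable ℂ f) {c : ℝ}
    (h : ∀ᶠ r in Filter.atTop, c ≤ maxTerm r f / maxModulus r f) : c ≤ erdosRatio f := by
  refine Filter.le_liminf_of_le (Filter.IsBoundedUnder.isCoboundedUnder_ge ⟨1, ?_⟩) h
  rw [Filter.eventually_map]
  filter_upwards [Filter.eventually_gt_atTop 0] with r hr
  exact maxTerm_div_maxModulus_le_one hf hr

theorem erdosRatio_le_erdosB {f : ℂ → ℂ} (hf : IsTranscendentalEntire f) :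
    erdosRatio f ≤ erdosB :=
  le_csSup ⟨1, by rintro _ ⟨g, hg, rfl⟩; exact erdosRatio_le_one hg.1⟩ ⟨f, hf, rfl⟩

/-- The maximum modulus principle on a closed annulus. -/
theorem norm_le_of_forall_boundary_annulus {g : ℂ → ℂ} {r R C : ℝ}
    (hg : DifferentiableOn ℂ g {z | r ≤ ‖z‖ ∧ ‖z‖ ≤ R})
    (h : ∀ z, ‖z‖ = r ∨ ‖z‖ = R → ‖g z‖ ≤ C) {z : ℂ} (hr : r ≤ ‖z‖) (hR : ‖z‖ ≤ R) :
    ‖g z‖ ≤ C := by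
  rcases hr.eq_or_lt with hr | hr
  · exact h z (Or.inl hr.symm)
  rcases hR.eq_or_lt with hR | hR
  · exact h z (Or.inr hR)
  set U : Set ℂ := {z | r < ‖z‖ ∧ ‖z‖ < R} with hU
  have hUo : IsOpen U :=
    (isOpen_lt continuous_const continuous_norm).inter (isOpen_lt continuous_norm continuous_const)
  have hcl : closure U ⊆ {z | r ≤ ‖z‖ ∧ ‖z‖ ≤ R} :=
    closure_minimal (fun z hz => ⟨hz.1.le, hz.2.le⟩)
      ((isClosed_le continuous_const continuous_norm).inter
        (isClosed_le continuous_norm continuous_const))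
  refine Complex.norm_le_of_forall_mem_frontier_norm_le (U := U)
    ((Metric.isBounded_ball (x := (0 : ℂ)) (r := R)).subset fun w hw => by simpa using hw.2)
    (hg.mono hcl).diffContOnCl (fun w hw => ?_) (subset_closure ⟨hr, hR⟩)
  rw [hUo.frontier_eq] at hw
  have hw1 := hcl hw.1
  by_contra hc
  refine hw.2 ⟨lt_of_le_of_ne hw1.1 fun e => hc (h w (Or.inl e.symm)),
    lt_of_le_of_ne hw1.2 fun e => hc (h w (Or.inr e))⟩

theorem taylorCoeff_eq_of_hasFPowerSeriesAt {f : ℂ → ℂ} {c : ℕ → ℂ}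
    (h : HasFPowerSeriesAt f (FormalMultilinearSeries.ofScalars ℂ c) 0) (n : ℕ) :
    taylorCoeff f n = c n :=
  congrFun (FormalMultilinearSeries.ofScalars_series_injective ℂ ℂ
    (HasFPowerSeriesAt.eq_formalMultilinearSeries h.analyticAt.hasFPowerSeriesAt h)) n

theorem taylorCoeff_polynomial_eq_zero (p : Polynomial ℂ) {n : ℕ} (hn : p.natDegree < n) :
    taylorCoeff (fun z => p.eval z) n = 0 := by
  have h : ∀ (k : ℕ), iteratedDeriv k (fun z => p.eval z)
      = fun z => ((⇑Polynomial.derivative)^[k] p).eval z := by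
    intro k
    induction k with
    | zero => simp
    | succ k ih =>
      rw [iteratedDeriv_succ, ih, Function.iterate_succ_apply']
      funext z
      exact Polynomial.deriv _
  rw [taylorCoeff, h, Polynomial.iterate_derivative_eq_zero hn]
  simp

/-! ### The coefficients of the scaling series. -/

theorem scalingCoeff_zero (K : ℝ) (ε : ℂ) : scalingCoeff K ε 0 = 1 := by
  simp [scalingCoeff]

theorem scalingCoeff_succ (K : ℝ) (ε : ℂ) (n : ℕ) :
    scalingCoeff K ε (n + 1) = scalingCoeff K ε n * (ε ^ n / (K : ℂ) ^ (n + 1)) := by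
  have h1 : (n + 1) * (n + 1 - 1) / 2 = n * (n - 1) / 2 + n := by
    rw [← Finset.sum_range_id, ← Finset.sum_range_id, Finset.sum_range_succ]
  have h2 : (n + 1) * (n + 1 + 1) / 2 = n * (n + 1) / 2 + (n + 1) := by
    have := Finset.sum_range_succ id (n + 1)
    simp only [id, Finset.sum_range_id, Nat.add_sub_cancel] at this
    rw [mul_comm, this, mul_comm (n + 1)]
  rw [scalingCoeff, scalingCoeff, h1, h2, pow_add, pow_add, mul_div_mul_comm]

theorem scalingCoeff_ne_zero {K : ℝ} {ε : ℂ} (hK : K ≠ 0) (hε : ε ≠ 0) (n : ℕ) :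
    scalingCoeff K ε n ≠ 0 :=
  div_ne_zero (pow_ne_zero _ hε) (pow_ne_zero _ (Complex.ofReal_ne_zero.2 hK))

section

variable {K : ℝ} {ε : ℂ}

theorem norm_scalingCoeff_succ (hK : 0 < K) (hε : ‖ε‖ = 1) (n : ℕ) :
    ‖scalingCoeff K ε (n + 1)‖ = ‖scalingCoeff K ε n‖ / K ^ (n + 1) := by
  rw [scalingCoeff_succ, norm_mul, norm_div, norm_pow, norm_pow, hε, Complex.norm_real,
    Real.norm_of_nonneg hK.le, one_pow, mul_one_div]

theorem hasFPowerSeriesOnBall_scalingFun (hK : 1 < K) (hε : ‖ε‖ = 1) :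
    HasFPowerSeriesOnBall (scalingFun K ε)
      (FormalMultilinearSeries.ofScalars ℂ (scalingCoeff K ε)) 0 ⊤ := by
  have hK0 : 0 < K := by linarith
  have hε0 : ε ≠ 0 := norm_ne_zero_iff.1 (by rw [hε]; norm_num)
  have hrad : (FormalMultilinearSeries.ofScalars ℂ (scalingCoeff K ε)).radius = ⊤ := by
    refine FormalMultilinearSeries.ofScalars_radius_eq_top_of_tendsto ℂ _
      (Filter.Eventually.of_forall fun n => scalingCoeff_ne_zero hK0.ne' hε0 n) ?_
    have h : Filter.Tendsto (fun n : ℕ => (K⁻¹) ^ (n + 1)) Filter.atTop (nhds 0) :=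
      (tendsto_pow_atTop_nhds_zero_of_lt_one (by positivity) (inv_lt_one_of_one_lt₀ hK)).comp
        (Filter.tendsto_add_atTop_nat 1)
    refine h.congr fun n => ?_
    have := norm_ne_zero_iff.2 (scalingCoeff_ne_zero hK0.ne' hε0 n)
    rw [Nat.succ_eq_add_one, norm_scalingCoeff_succ hK0 hε, inv_pow]
    field_simp
  have h := FormalMultilinearSeries.hasFPowerSeriesOnBall
    (FormalMultilinearSeries.ofScalars ℂ (scalingCoeff K ε)) (by rw [hrad]; exact ENNReal.zero_lt_top)
  rw [hrad] at h
  convert h using 1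
  funext z
  simp only [scalingFun, FormalMultilinearSeries.sum, FormalMultilinearSeries.ofScalars_apply_eq,
    smul_eq_mul]

theorem summable_scalingCoeff_mul_pow (hK : 1 < K) (hε : ‖ε‖ = 1) (z : ℂ) :
    Summable fun n : ℕ => scalingCoeff K ε n * z ^ n := by
  have h := (hasFPowerSeriesOnBall_scalingFun hK hε).hasSum (y := z) (by simp)
  simpa only [FormalMultilinearSeries.ofScalars_apply_eq, smul_eq_mul] using h.summable

theorem taylorCoeff_scalingFun (hK : 1 < K) (hε : ‖ε‖ = 1) (n : ℕ) :
    taylorCoeff (scalingFun K ε) n = scalingCoeff K ε n :=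
  taylorCoeff_eq_of_hasFPowerSeriesAt (hasFPowerSeriesOnBall_scalingFun hK hε).hasFPowerSeriesAt n

theorem isTranscendentalEntire_scalingFun (hK : 1 < K) (hε : ‖ε‖ = 1) :
    IsTranscendentalEntire (scalingFun K ε) := by
  refine ⟨?_, ?_⟩
  · have := (hasFPowerSeriesOnBall_scalingFun hK hε).differentiableOn
    rwa [Metric.eball_top, differentiableOn_univ] at this
  -- No coefficient vanishes, whereas those of a polynomial vanish beyond its degree.
  · rintro ⟨p, hp⟩
    have h := taylorCoeff_scalingFun hK hε (p.natDegree + 1)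
    rw [funext hp, taylorCoeff_polynomial_eq_zero p (Nat.lt_succ_self _)] at h
    exact scalingCoeff_ne_zero (by linarith) (norm_ne_zero_iff.1 (by rw [hε]; norm_num)) _ h.symm

/-- The `j`-th term after the central one, relative to the central term `a_{m+1} z^{m+1}`. -/
theorem scalingCoeff_mul_pow_add (hK : K ≠ 0) (z : ℂ) (m j : ℕ) :
    scalingCoeff K ε (m + 1 + j) * z ^ (m + 1 + j) = scalingCoeff K ε (m + 1) * z ^ (m + 1) *
      ((ε / K) ^ (∑ i ∈ Finset.range (j + 1), i) * (z * ε ^ m / (K : ℂ) ^ (m + 1)) ^ j) := by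
  have hK' : (K : ℂ) ≠ 0 := Complex.ofReal_ne_zero.2 hK
  induction j with
  | zero => simp
  | succ j ih =>
    rw [← add_assoc, scalingCoeff_succ, pow_succ z, Finset.sum_range_succ _ (j + 1),
      pow_add _ _ (j + 1), pow_succ (z * ε ^ m / (K : ℂ) ^ (m + 1)) j]
    calc _ = scalingCoeff K ε (m + 1 + j) * z ^ (m + 1 + j)
          * (ε ^ (m + 1 + j) / (K : ℂ) ^ (m + 1 + j + 1) * z) := by ring
      _ = _ := by
          rw [ih]
          generalize (ε / (K : ℂ)) ^ (∑ i ∈ Finset.range (j + 1), i) = y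
          generalize (z * ε ^ m / (K : ℂ) ^ (m + 1)) ^ j = x
          simp only [div_pow, pow_add, pow_one]
          field_simp

/-- The `j`-th term before the central ones, relative to the central term `a_{m+1} z^{m+1}`. -/
theorem scalingCoeff_mul_pow_sub (hK : K ≠ 0) (z : ℂ) (k j : ℕ) :
    scalingCoeff K ε k * z ^ k * (z * ε ^ (k + j) / (K : ℂ) ^ (k + j + 1)) ^ (j + 1) =
      scalingCoeff K ε (k + j + 1) * z ^ (k + j + 1) *
        (ε / K) ^ (∑ i ∈ Finset.range (j + 1), i) := by
  have hK' : (K : ℂ) ≠ 0 := Complex.ofReal_ne_zero.2 hK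
  -- The sum `k + j` stays fixed when `k` rises and `j` falls by one, so the central term and the
  -- base of the power do not change.
  induction j generalizing k with
  | zero =>
    rw [scalingCoeff_succ]
    simp
    ring
  | succ j ih =>
    have h := ih (k + 1)
    rw [show k + 1 + j = k + (j + 1) by ring] at h
    rw [Finset.sum_range_succ _ (j + 1), pow_add (ε / (K : ℂ)), ← mul_assoc, ← h, scalingCoeff_succ,
      pow_succ _ (j + 1)]
    generalize (z * ε ^ (k + (j + 1)) / (K : ℂ) ^ (k + (j + 1) + 1)) ^ (j + 1) = y
    simp only [div_pow, pow_add, pow_one]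
    field_simp

end

/-! ### Truncated theta series on the unit circle. -/

theorem add_le_sum_range_id (j : ℕ) : 10 + j ≤ ∑ i ∈ Finset.range (j + 4 + 1), i := by
  induction j with
  | zero => decide
  | succ j ih =>
    rw [show j + 1 + 4 + 1 = j + 4 + 1 + 1 by ring, Finset.sum_range_succ _ (j + 4 + 1)]
    omega

/-- One-sided truncations of the theta series `∑_{j ∈ ℤ} q^{j(j+1)/2} u^j` on the unit circle. -/
theorem norm_theta_truncation_le {q u : ℂ}
    (hq : q = Complex.exp (Complex.I * ((198074929 / 50000000 : ℝ) : ℂ)) / ((7137 / 2000 : ℝ) : ℂ))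
    (hu : ‖u‖ = 1) (l : ℕ)
    (hs : Summable fun j : ℕ => q ^ (∑ i ∈ Finset.range (j + 1), i) * u ^ j) :
    ‖∑ j ∈ Finset.range (l + 4), q ^ (∑ i ∈ Finset.range (j + 1), i) * u⁻¹ ^ (j + 1)
      + ∑' j : ℕ, q ^ (∑ i ∈ Finset.range (j + 1), i) * u ^ j‖ ≤ 1.709196 := by
  have hqn : ‖q‖ = 2000 / 7137 := by
    rw [hq, norm_div, mul_comm, Complex.norm_exp_ofReal_mul_I, Complex.norm_real]
    norm_num
  have hgeom : HasSum (fun i : ℕ => (2000 / 7137 : ℝ) ^ 10 * (1 / 3) ^ i)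
      ((2000 / 7137) ^ 10 * (1 - 1 / 3)⁻¹) :=
    (hasSum_geometric_of_lt_one (by norm_num) (by norm_num)).mul_left _
  have hterm : ∀ (j : ℕ) (w : ℂ), ‖w‖ = 1 →
      ‖q ^ (∑ i ∈ Finset.range (j + 4 + 1), i) * w‖ ≤ (2000 / 7137 : ℝ) ^ 10 * (1 / 3) ^ j := by
    intro j w hw
    rw [norm_mul, hw, mul_one, norm_pow, hqn]
    calc (2000 / 7137 : ℝ) ^ (∑ i ∈ Finset.range (j + 4 + 1), i)
        ≤ (2000 / 7137) ^ (10 + j) :=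
          pow_le_pow_of_le_one (by norm_num) (by norm_num) (add_le_sum_range_id j)
      _ = (2000 / 7137) ^ 10 * (2000 / 7137) ^ j := pow_add _ _ _
      _ ≤ _ := by
          have : (2000 / 7137 : ℝ) ≤ 1 / 3 := by norm_num
          gcongr
  have htail1 : ‖∑ j ∈ Finset.range l,
      q ^ (∑ i ∈ Finset.range (j + 4 + 1), i) * u⁻¹ ^ (j + 4 + 1)‖
      ≤ (2000 / 7137) ^ 10 * (1 - 1 / 3)⁻¹ :=
    (norm_sum_le_of_le _ fun j _ => hterm j _ (by rw [norm_pow, norm_inv, hu]; simp)).trans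
      (sum_le_hasSum _ (fun _ _ => by positivity) hgeom)
  have htail2 : ‖∑' j : ℕ, q ^ (∑ i ∈ Finset.range (j + 4 + 1), i) * u ^ (j + 4)‖
      ≤ (2000 / 7137) ^ 10 * (1 - 1 / 3)⁻¹ :=
    tsum_of_norm_bounded hgeom fun j => hterm j _ (by rw [norm_pow, hu, one_pow])
  -- A square root of `u` makes the series symmetric about `j = -1/2`.
  obtain ⟨v, rfl⟩ : ∃ v : ℂ, u = v ^ 2 := by
    obtain ⟨v, hv⟩ := IsAlgClosed.exists_pow_nat_eq u (n := 2) (by norm_num)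
    exact ⟨v, hv.symm⟩
  have hv : ‖v‖ = 1 := by
    rw [norm_pow] at hu
    exact (pow_eq_one_iff_of_nonneg (norm_nonneg v) two_ne_zero).1 hu
  have hv0 : v ≠ 0 := norm_ne_zero_iff.1 (by rw [hv]; norm_num)
  rw [add_comm l 4, Finset.sum_range_add, ← hs.sum_add_tsum_nat_add 4]
  simp only [add_comm 4]
  have hmain : ∑ j ∈ Finset.range 4, q ^ (∑ i ∈ Finset.range (j + 1), i) * (v ^ 2)⁻¹ ^ (j + 1)
      + ∑ j ∈ Finset.range 4, q ^ (∑ i ∈ Finset.range (j + 1), i) * (v ^ 2) ^ j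
      = v⁻¹ * ((v + v⁻¹) + q * (v ^ 3 + v⁻¹ ^ 3) + q ^ 3 * (v ^ 5 + v⁻¹ ^ 5)
        + q ^ 6 * (v ^ 7 + v⁻¹ ^ 7)) := by
    simp [Finset.sum_range_succ]
    field_simp
    ring
  rw [show ∀ a b c d : ℂ, a + b + (c + d) = (a + c) + (b + d) by intros; ring, hmain]
  refine (norm_add_le _ _).trans ((add_le_add (?_ : _ ≤ (1.709186 : ℝ))
    ((norm_add_le _ _).trans (add_le_add htail1 htail2))).trans ?_)
  · rw [norm_mul, norm_inv, hv, inv_one, one_mul]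
    exact norm_theta_main_le hq hv
  -- Each tail is at most `(3/2)(2000/7137)^10 < 5e-6`.
  · norm_num

/-! ### From the critical circles to all large radii. -/

section

variable {K : ℝ} {ε : ℂ}

/-- The condition `3 ≤ m` leaves at least four terms below the central one, so that all four
dominant pairs are complete. -/
theorem norm_scalingFun_le_of_norm_eq_pow (hK : K = 7137 / 2000)
    (hε : ε = Complex.exp (Complex.I * ((198074929 / 50000000 : ℝ) : ℂ))) {m : ℕ} (hm : 3 ≤ m)
    {z : ℂ} (hz : ‖z‖ = K ^ (m + 1)) :
    ‖scalingFun K ε z‖ ≤ 1.709196 * (‖scalingCoeff K ε (m + 1)‖ * ‖z‖ ^ (m + 1)) := by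
  have hK1 : 1 < K := by rw [hK]; norm_num
  have hK0 : K ≠ 0 := by linarith
  have hKp : 0 < K := by linarith
  have hε1 : ‖ε‖ = 1 := by rw [hε, mul_comm, Complex.norm_exp_ofReal_mul_I]
  have hε0 : ε ≠ 0 := norm_ne_zero_iff.1 (by rw [hε1]; norm_num)
  set u : ℂ := z * ε ^ m / (K : ℂ) ^ (m + 1) with hu
  have hu1 : ‖u‖ = 1 := by
    rw [hu, norm_div, norm_mul, norm_pow, norm_pow, hε1, hz, Complex.norm_real,
      Real.norm_of_nonneg hKp.le, one_pow, mul_one, div_self (by positivity)]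
  have hu0 : u ≠ 0 := norm_ne_zero_iff.1 (by rw [hu1]; norm_num)
  have hz0 : z ≠ 0 := norm_ne_zero_iff.1 (by rw [hz]; positivity)
  set A : ℂ := scalingCoeff K ε (m + 1) * z ^ (m + 1) with hA
  have hA0 : A ≠ 0 := mul_ne_zero (scalingCoeff_ne_zero hK0 hε0 _) (pow_ne_zero _ hz0)
  have hsum := summable_scalingCoeff_mul_pow hK1 hε1 z
  have hup : ∀ j, scalingCoeff K ε (j + (m + 1)) * z ^ (j + (m + 1))
      = A * ((ε / K) ^ (∑ i ∈ Finset.range (j + 1), i) * u ^ j) := fun j => by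
    rw [add_comm j]
    exact scalingCoeff_mul_pow_add hK0 z m j
  have hdown : ∑ k ∈ Finset.range (m + 1), scalingCoeff K ε k * z ^ k
      = A * ∑ j ∈ Finset.range (m + 1), (ε / K) ^ (∑ i ∈ Finset.range (j + 1), i)
        * u⁻¹ ^ (j + 1) := by
    rw [← Finset.sum_range_reflect, Finset.mul_sum]
    refine Finset.sum_congr rfl fun j hj => ?_
    obtain ⟨k, rfl⟩ := Nat.exists_eq_add_of_le' (Nat.lt_succ_iff.1 (Finset.mem_range.1 hj))
    have := scalingCoeff_mul_pow_sub (ε := ε) hK0 z k j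
    rw [← hu, ← hA] at this
    rw [show k + j + 1 - 1 - j = k by omega, inv_pow, ← mul_assoc, ← this]
    field_simp
  have hs : Summable fun j : ℕ => (ε / K) ^ (∑ i ∈ Finset.range (j + 1), i) * u ^ j := by
    have := (summable_nat_add_iff (m + 1)).2 hsum
    simp only [hup] at this
    exact (summable_mul_left_iff hA0).1 this
  obtain ⟨l, rfl⟩ := Nat.exists_eq_add_of_le' hm
  have hf : scalingFun K ε z = A * (∑ j ∈ Finset.range (l + 4),
      (ε / K) ^ (∑ i ∈ Finset.range (j + 1), i) * u⁻¹ ^ (j + 1)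
      + ∑' j : ℕ, (ε / K) ^ (∑ i ∈ Finset.range (j + 1), i) * u ^ j) := by
    rw [scalingFun, ← hsum.sum_add_tsum_nat_add (l + 3 + 1), hdown, mul_add, ← tsum_mul_left]
    simp only [hup]
  rw [hf, ← norm_pow, ← norm_mul, ← hA, norm_mul, mul_comm]
  gcongr
  exact norm_theta_truncation_le (by rw [hε, hK]) hu1 l hs

theorem norm_scalingFun_le (hK : K = 7137 / 2000)
    (hε : ε = Complex.exp (Complex.I * ((198074929 / 50000000 : ℝ) : ℂ))) {m : ℕ} (hm : 3 ≤ m)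
    {z : ℂ} (hz : K ^ (m + 1) ≤ ‖z‖) (hz' : ‖z‖ ≤ K ^ (m + 2)) :
    ‖scalingFun K ε z‖ ≤ 1.709196 * (‖scalingCoeff K ε (m + 1)‖ * ‖z‖ ^ (m + 1)) := by
  have hK1 : 1 < K := by rw [hK]; norm_num
  have hKp : 0 < K := by linarith
  have hε1 : ‖ε‖ = 1 := by rw [hε, mul_comm, Complex.norm_exp_ofReal_mul_I]
  have hpos : ∀ w : ℂ, K ^ (m + 1) ≤ ‖w‖ → 0 < ‖w‖ := fun w hw => (pow_pos hKp _).trans_le hw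
  have hdiv : ∀ (w : ℂ) (C : ℝ), 0 < ‖w‖ →
      (‖scalingFun K ε w / w ^ (m + 1)‖ ≤ C ↔ ‖scalingFun K ε w‖ ≤ C * ‖w‖ ^ (m + 1)) := by
    intro w C hw
    rw [norm_div, norm_pow, div_le_iff₀ (by positivity)]
  have hle : K ^ (m + 1) ≤ K ^ (m + 2) := pow_le_pow_right₀ hK1.le (by omega)
  rw [← mul_assoc, ← hdiv z _ (hpos z hz)]
  refine norm_le_of_forall_boundary_annulus (g := fun w => scalingFun K ε w / w ^ (m + 1))
    ?_ (fun w hw => ?_) hz hz'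
  · refine (isTranscendentalEntire_scalingFun hK1 hε1).1.differentiableOn.div
      (differentiable_pow _).differentiableOn fun w hw => pow_ne_zero _ ?_
    exact norm_pos_iff.1 (hpos w hw.1)
  · have hw0 : 0 < ‖w‖ := hpos w (by rcases hw with hw | hw <;> rw [hw]; exact hle)
    rw [hdiv w _ hw0, mul_assoc]
    rcases hw with hw | hw
    · exact norm_scalingFun_le_of_norm_eq_pow hK hε hm hw
    -- On the outer circle the terms of index `m+1` and `m+2` have equal modulus, so the bound for
    -- `m+1` has the form required for `m`.
    · refine (norm_scalingFun_le_of_norm_eq_pow hK hε (hm.trans (Nat.le_succ m)) hw).trans_eq ?_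
      rw [norm_scalingCoeff_succ hKp hε1 (m + 1), Nat.succ_eq_add_one, hw,
        pow_succ (K ^ (m + 2)) (m + 1)]
      field_simp

theorem le_maxTerm_div_maxModulus_scalingFun (hK : K = 7137 / 2000)
    (hε : ε = Complex.exp (Complex.I * ((198074929 / 50000000 : ℝ) : ℂ))) {r : ℝ}
    (hr : K ^ 4 ≤ r) :
    1 / 1.709196 ≤ maxTerm r (scalingFun K ε) / maxModulus r (scalingFun K ε) := by
  have hK1 : 1 < K := by rw [hK]; norm_num
  have hε1 : ‖ε‖ = 1 := by rw [hε, mul_comm, Complex.norm_exp_ofReal_mul_I]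
  have hr1 : 1 ≤ r := (one_le_pow₀ hK1.le).trans hr
  have hr0 : 0 < r := by linarith
  have hd := (isTranscendentalEntire_scalingFun hK1 hε1).1
  obtain ⟨n, hn, hn'⟩ := exists_nat_pow_near hr1 hK1
  have hn4 : 4 < n + 1 := (pow_lt_pow_iff_right₀ hK1).1 (hr.trans_lt hn')
  obtain ⟨m, rfl⟩ := Nat.exists_eq_add_of_le' (show 1 ≤ n by omega)
  have hM : maxModulus r (scalingFun K ε) ≤ 1.709196 * maxTerm r (scalingFun K ε) := by
    refine maxModulus_le hr0.le fun z hz => ?_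
    refine (norm_scalingFun_le hK hε (show 3 ≤ m by omega) (by rwa [hz]) (by rw [hz]; exact hn'.le)).trans ?_
    rw [hz, ← taylorCoeff_scalingFun hK1 hε1]
    gcongr
    exact le_maxTerm hd hr0 _
  have hM0 : 0 < maxModulus r (scalingFun K ε) := by
    -- The constant term 1 bounds the maximum modulus from below.
    have h := norm_taylorCoeff_mul_pow_le hd hr0 0
    rw [taylorCoeff_scalingFun hK1 hε1, scalingCoeff_zero] at h
    norm_num at h
    linarith
  rw [div_le_div_iff₀ (by norm_num) hM0]
  linarith

end

theorem theorem1p2 (K₀ α₀ : ℝ) (ε₀ : ℂ)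
    (hK₀ : K₀ = 7137 / 2000)
    (hα₀ : α₀ = 198074929 / 50000000)
    (hε₀ : ε₀ = Complex.exp (Complex.I * (α₀ : ℂ))) :
    (1 < K₀ ∧ ‖ε₀‖ = 1) ∧
    (∀ z : ℂ, Summable (fun n : ℕ => scalingCoeff K₀ ε₀ n * z ^ n)) ∧
    IsTranscendentalEntire (scalingFun K₀ ε₀) ∧
    (0.58507 : ℝ) < erdosRatio (scalingFun K₀ ε₀) ∧
    (0.58507 : ℝ) < erdosB := by
  have hK1 : 1 < K₀ := by rw [hK₀]; norm_num
  have hε1 : ‖ε₀‖ = 1 := by rw [hε₀, mul_comm, Complex.norm_exp_ofReal_mul_I]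
  have ht := isTranscendentalEntire_scalingFun hK1 hε1
  have hβ : (0.58507 : ℝ) < erdosRatio (scalingFun K₀ ε₀) := by
    refine lt_of_lt_of_le (by norm_num : (0.58507 : ℝ) < 1 / 1.709196) (le_erdosRatio ht.1 ?_)
    filter_upwards [Filter.eventually_ge_atTop (K₀ ^ 4)] with r hr
    exact le_maxTerm_div_maxModulus_scalingFun hK₀ (by rw [hε₀, hα₀]) hr
  exact ⟨⟨hK1, hε1⟩, summable_scalingCoeff_mul_pow hK1 hε1, ht, hβ,
    hβ.trans_le (erdosRatio_le_erdosB ht)⟩
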